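/- A binary word is called $1$-decreasing if each of its length-maximal factors of the form $0^a1^b$ with $a>0$ satisfies $a>b$. For $n\ge 0$ let $\mathcal Z_n$ be the set of $1$-decreasing words of length $n$ that start with $0$ (with $\mathcal Z_0=\{\epsilon\}$, $\epsilon$ the empty word). A $1$-Gray code for a set of words of length $n$ is a list containing each word of the set exactly once, in which consecutive words differ in at most one position. For words $p,v$, with $n$ understood, $p\,v^*$ is the word of length $n$ obtained from $pvvv\cdots$ by trimming. For lists, $\circ$ and $\bigcirc$ denote concatenation ($\bigcirc_{i=a}^{1}$ runs through $i=a,a-1,\dots,1$), $\overline{L}$ is the reverse of $L$, $\widehat L$ is $L$ without its first element, $\mathrm{first}(L)$ and $\mathrm{last}(L)$ are its first and last elements, $\langle L\rangle^i$ is $L$ for even $i$ and $\overline L$ for odd $i$, and $wL$ is $L$ with the word $w$ put in front of each element. **Theorem.** For every $n\ge 0$ there is a $1$-Gray code $Z_n$ for $\mathcal Z_n$ with $\mathrm{first}(Z_n)=0(001)^*$ and $\mathrm{last}(Z_n)=(001)^*$ (both of length $n$). More precisely, these properties hold for all $n$ for the lists built recursively as follows: $Z_0=\epsilon$, $Z_1=0$,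 $Z_2=00$, $Z_3=000\circ 001$, and for $n\ge 4$ $$Z_n=\Delta^5_n\circ\Delta^9_n\circ\Delta^{13}_n\circ\cdots\ \circ\ E_n\circ 0^n\circ\ \cdots\circ\Delta^{11}_n\circ\Delta^7_n\circ\Delta^3_n ,$$ where the first group consists of all $\Delta^r_n$ with $r\equiv1 \pmod 4$, $5\le r\le n$, in increasing order of $r$, the last group of all $\Delta_n^r$ with $r\equiv 3\pmod 4$, $3\le r\le n$, in decreasing order of $r$, $E_n$ is the one-word list $0^{n-1}1$ if $4\mid n$ and is empty otherwise, and the blocks $\Delta^r_n$ are the following lists. If $r\equiv 1\pmod 4$: - if $r\ne n-1$, $\ \Delta^r_n=\bigcirc_{j=1}^{(r-3)/2}0^{r-1-j}1^j\langle Z_{n-r+1}\rangle^j\circ\overline{\bigcirc_{j=1}^{(r-1)/2}0^{r-j}1^j\langle Z_{n-r}\rangle^j}$; - if $r=n-1$, $\ \Delta^{n-1}_n=\bigcirc_{j=1}^{(n-4)/2}0^{n-2-j}1^j00\circ 0^{n/2}1^{(n-2)/2}0\circ\overline{\bigcirc_{j=1}^{(n-4)/2}\langle 0^{n-j-1}1^{j+1}\circ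 0^{n-1-j}1^j0\rangle^{j-1}}\circ 0^{n-1}1$. If $r\equiv 3\pmod 4$ (the first case that applies): - if $r=3$, $\ \Delta^3_n=001\,Z_{n-3}$; - if $r=n-2$, $\ \Delta^{n-2}_n=\bigcirc_{j=1}^{(n-5)/2}0^{n-3-j}1^j\langle Z_3\rangle^{j-1}\circ\overline{\bigcirc_{j=1}^{(n-3)/2}0^{n-2-j}1^jZ_2}$; - if $r=n-1$, $\ \Delta^{n-1}_n=\bigcirc_{j=1}^{(n-4)/2}0^{n-2-j}1^jZ_2\circ 0^{n/2}1^{(n-2)/2}Z_1\circ\overline{\bigcirc_{j=1}^{(n-4)/2}\langle 0^{n-1-j}1^{j+1}\circ 0^{n-1-j}1^jZ_1\rangle^{j}}$; - if $r=n$, $\ \Delta^{n}_n=\bigcirc_{j=1}^{(n-3)/2}0^{n-1-j}1^j0\circ\overline{\bigcirc_{j=1}^{(n-1)/2}0^{n-j}1^j}$; - otherwise, with $a=(r-3)/2$, $K_i=0^{r-1-i}1^iZ_{n-r+1}$ and $L_i=0^{r-i}1^iZ_{n-r}$, $\ \Delta^r_n=\bigcirc_{i=1}^{a+1}\mathrm{first}(L_i)\circ\bigcirc_{i=a}^{1}\langle\widehat{L_{i+1}}\circ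 K_i\rangle^i\circ\widehat{L_1}$. -/

import Mathlib

namespace RunDecreasing

/-- Finite binary words; `false` is the letter `0` and `true` is the letter `1`. -/
abbrev Word := List Bool

/-- The word `0 ^ a 1 ^ b`. -/
def run (a b : ℕ) : Word := List.replicate a false ++ List.replicate b true

/-- In the word `u · 0 ^ a 1 ^ b · v`, with `a > 0`, the displayed factor `0 ^ a 1 ^ b` is length
maximal: it cannot be prolonged, to the left or to the right, to a longer factor of that form.
(On the left only a `0` could be added; on the right a `1` could be added, and also a `0` if
there is no `1` yet.) -/
def IsMaximalRun (u : Word) (b : ℕ) (v : Word) : Prop :=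
  u.getLast? ≠ some false ∧ v.head? ≠ some true ∧ (b = 0 → v.head? ≠ some false)

/-- A word is `q`-decreasing if each of its length maximal factors `0 ^ a 1 ^ b` with `a > 0`
satisfies `q * a > b`. -/
def IsDecreasing (q : ℕ) (w : Word) : Prop :=
  ∀ (u v : Word) (a b : ℕ), 0 < a → w = u ++ run a b ++ v → IsMaximalRun u b v → b < q * a

/-- The set of `1`-decreasing words of length `n` that start with `0`; for `n = 0` it consists of
the empty word. -/
def zSet (n : ℕ) : Set Word :=
  {w | w.length = n ∧ IsDecreasing 1 w ∧ (n ≠ 0 → w.head? = some false)}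

/-- The Hamming distance of two words of the same length: the number of positions at which they
differ. -/
def hamming (u v : Word) : ℕ := ((u.zip v).filter (fun p => p.1 != p.2)).length

/-- `L` is a `k`-Gray code for the set `A` of words of length `n`: it lists every word of `A`
exactly once and nothing else, and consecutive words are at Hamming distance at most `k`. -/
def IsGrayCode (k n : ℕ) (A : Set Word) (L : List Word) : Prop :=
  (∀ w ∈ A, w.length = n) ∧ L.Nodup ∧ (∀ w, w ∈ L ↔ w ∈ A) ∧
    L.IsChain (fun u v => hamming u v ≤ k)

/-- The word `p · v ^ *` of length `n`: `p` followed by as many copies of `v` as needed, trimmed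
to length `n` (for nonempty `v`). -/
def starWord (p v : Word) (n : ℕ) : Word := (p ++ (List.replicate n v).flatten).take n

/-- The factor `001`. -/
def w001 : Word := [false, false, true]

/-- `w · L`: the word `w` is put in front of every word of the list `L`. -/
def pre (w : Word) (L : List Word) : List Word := L.map (fun x => w ++ x)

/-- `⟨L⟩ ^ i`: the list `L` if `i` is even, the reverse of `L` if `i` is odd. -/
def alt (i : ℕ) (L : List Word) : List Word := if i % 2 = 0 then L else L.reverse

/-- The concatenation of the lists `F 1, F 2, …, F m`. -/
def cat (m : ℕ) (F : ℕ → List Word) : List Word := (List.range' 1 m).flatMap F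

/-- The concatenation of the lists `F m, F (m - 1), …, F 1`. -/
def catDown (m : ℕ) (F : ℕ → List Word) : List Word := (List.range' 1 m).reverse.flatMap F

/-- The block `Δ ^ r _ n` for `r ≡ 1 (mod 4)`, `5 ≤ r ≤ n`, built from the lists `Z k`, `k < n`. -/
def deltaOne (Z : ℕ → List Word) (n r : ℕ) : List Word :=
  if r = n - 1 then
    cat ((n - 4) / 2) (fun j => [run (n - 2 - j) j ++ run 2 0])
      ++ [run (n / 2) ((n - 2) / 2) ++ run 1 0]
      ++ (cat ((n - 4) / 2) (fun j =>
            alt (j - 1) [run (n - j - 1) (j + 1), run (n - 1 - j) j ++ run 1 0])).reverse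
      ++ [run (n - 1) 1]
  else
    cat ((r - 3) / 2) (fun j => pre (run (r - 1 - j) j) (alt j (Z (n - r + 1))))
      ++ (cat ((r - 1) / 2) (fun j => pre (run (r - j) j) (alt j (Z (n - r))))).reverse

/-- The block `Δ ^ r _ n` for `r ≡ 3 (mod 4)`, `3 ≤ r ≤ n`, `3 < n`, built from the lists `Z k`,
`k < n`. In the last case `K i` and `L i` are the lists for the sets
`0 ^ (r - 1 - i) 1 ^ i · 𝒵_(n - r + 1)` and `0 ^ (r - i) 1 ^ i · 𝒵_(n - r)`. -/
def deltaThree (Z : ℕ → List Word) (n r : ℕ) : List Word :=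
  if r = 3 then
    pre (run 2 1) (Z (n - 3))
  else if r = n - 2 then
    cat ((n - 5) / 2) (fun j => pre (run (n - 3 - j) j) (alt (j - 1) (Z 3)))
      ++ (cat ((n - 3) / 2) (fun j => pre (run (n - 2 - j) j) (Z 2))).reverse
  else if r = n - 1 then
    cat ((n - 4) / 2) (fun j => pre (run (n - 2 - j) j) (Z 2))
      ++ pre (run (n / 2) ((n - 2) / 2)) (Z 1)
      ++ (cat ((n - 4) / 2) (fun j =>
            alt j ([run (n - 1 - j) (j + 1)] ++ pre (run (n - 1 - j) j) (Z 1)))).reverse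
  else if r = n then
    cat ((n - 3) / 2) (fun j => [run (n - 1 - j) j ++ run 1 0])
      ++ (cat ((n - 1) / 2) (fun j => [run (n - j) j])).reverse
  else
    let a := (r - 3) / 2
    let K : ℕ → List Word := fun i => pre (run (r - 1 - i) i) (Z (n - r + 1))
    let L : ℕ → List Word := fun i => pre (run (r - i) i) (Z (n - r))
    cat (a + 1) (fun i => (L i).take 1)
      ++ catDown a (fun i => alt i ((L (i + 1)).tail ++ K i))
      ++ (L 1).tail

/-- The list built from the blocks, for `n ≥ 4`: first the blocks `Δ ^ r _ n` with
`r ≡ 1 (mod 4)`, `5 ≤ r ≤ n`, in increasing order of `r`; then, if `4 ∣ n`, the word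
`0 ^ (n - 1) 1`; then `0 ^ n`; then the blocks `Δ ^ r _ n` with `r ≡ 3 (mod 4)`, `3 ≤ r ≤ n`, in
decreasing order of `r`. -/
def assemble (Z : ℕ → List Word) (n : ℕ) : List Word :=
  ((List.range (n + 1)).filter (fun r => r % 4 = 1 ∧ 5 ≤ r)).flatMap (deltaOne Z n)
    ++ (if n % 4 = 0 then [run (n - 1) 1] else [])
    ++ [run n 0]
    ++ ((List.range (n + 1)).filter (fun r => r % 4 = 3)).reverse.flatMap (deltaThree Z n)

/-- The family of lists `Z 0, Z 1, Z 2, …` is built recursively: four initial lists, and the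
assembly of the blocks from the shorter lists from `n = 4` on. This determines the family. -/
def IsDiagonalFamily (Z : ℕ → List Word) : Prop :=
  Z 0 = [[]] ∧ Z 1 = [run 1 0] ∧ Z 2 = [run 2 0] ∧ Z 3 = [run 3 0, run 2 1] ∧
    ∀ n, 4 ≤ n → Z n = assemble Z n

end RunDecreasing

/-!
A nonempty word of `𝒵_n` other than `0 ^ n` is in a unique way `0 ^ a 1 ^ b v` with `0 < b < a`
and `v ∈ 𝒵_(n - a - b)` (`mem_zSet_iff`, `run_append_inj`). The block for the odd number `r` lists
the words with `a + b ∈ {r - 1, r}`; if `n` is even, the block for `r = n - 1`, together with the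
extra word `0 ^ (n - 1) 1` if `4 ∣ n`, contains those with `a + b = n` as well. Comparing multisets
(`coe_deltaOne`, `coe_deltaThree`, `coe_assemble`) one finds by induction that each word of `𝒵_n` is
listed exactly once.

For the Gray property, write `α_k = 0(001)^*` and `β_k = (001)^*` for the first and the last word of
`Z k`. They satisfy `α_(k+1) = 0 β_k` and `β_(k+3) = 001 β_k`. All the transitions between the pieces
of a block are of one of three kinds: a `0` at the end of a run becomes a `1` or conversely
(`adj_run`), the `0` after a run becomes a `1` or conversely (`adj_run_cons`), or `v` takes its first
step along `Z k`. In general the block for `r ≡ 1 (mod 4)` leads from `0 ^ (r - 2) 1 β_(n-r+1)` to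
`0 ^ (r - 1) 1 β_(n-r)`, and the block for `r ≡ 3 (mod 4)` from `0 ^ (r - 1) 1 α_(n-r)` to
`0 ^ (r - 1) 1 β_(n-r)`. The recursions for `α` and `β` show that, from one block to the next, the
words differ only in one `1` that splits a run of `0`s (`adj_run_run`). The blocks with `r` close to
`n` have a slightly different form, and the passage through `0 ^ n` is a change of a single letter
for each residue of `n` modulo `4`.
-/

namespace RunDecreasing

/-! ### Run decompositions of decreasing words -/

lemma run_succ_append (a b : ℕ) (v : Word) : run (a + 1) b ++ v = false :: (run a b ++ v) := rfl

@[simp] lemma length_run (a b : ℕ) : (run a b).length = a + b := by simp [run]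

lemma replicate_true_append_inj {v v' : Word} (hv : v.head? ≠ some true)
    (hv' : v'.head? ≠ some true) :
    ∀ {b b' : ℕ}, List.replicate b true ++ v = List.replicate b' true ++ v' → b = b' ∧ v = v'
  | 0, 0, h => ⟨rfl, by simpa using h⟩
  | 0, b' + 1, h => by
    have : v = true :: (List.replicate b' true ++ v') := by simpa [List.replicate_succ] using h
    simp [this] at hv
  | b + 1, 0, h => by
    have : v' = true :: (List.replicate b true ++ v) := by
      simpa [List.replicate_succ] using h.symm
    simp [this] at hv'
  | b + 1, b' + 1, h => by
    obtain ⟨h1, h2⟩ := replicate_true_append_inj hv hv' (b := b) (b' := b')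
      (by simpa [List.replicate_succ] using h)
    exact ⟨by omega, h2⟩

/-- The run at the beginning of a word is unique, as soon as it contains a `1` and is not followed
by a further `1`. -/
lemma run_append_inj {v v' : Word} (hv : v.head? ≠ some true) (hv' : v'.head? ≠ some true) :
    ∀ {a a' b b' : ℕ}, 0 < b → 0 < b' → run a b ++ v = run a' b' ++ v' →
      a = a' ∧ b = b' ∧ v = v'
  | 0, 0, b, b', _, _, h => ⟨rfl, replicate_true_append_inj hv hv' h⟩
  | 0, a' + 1, b + 1, b', _, _, h => by
    simp [run, List.replicate_succ] at h
  | a + 1, 0, b, b' + 1, _, _, h => by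
    simp [run, List.replicate_succ] at h
  | a + 1, a' + 1, b, b', hb, hb', h => by
    rw [run_succ_append, run_succ_append, List.cons.injEq] at h
    obtain ⟨h1, h2⟩ := run_append_inj hv hv' hb hb' h.2
    exact ⟨by omega, h2⟩

lemma exists_replicate_true_append (w : Word) :
    ∃ b v, w = List.replicate b true ++ v ∧ v.head? ≠ some true := by
  induction w with
  | nil => exact ⟨0, [], by simp⟩
  | cons c w ih =>
    cases c with
    | false => exact ⟨0, false :: w, by simp⟩
    | true =>
      obtain ⟨b, v, rfl, hv⟩ := ih
      exact ⟨b + 1, v, by simp [List.replicate_succ], hv⟩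

lemma exists_run_append (w : Word) :
    ∃ a b v, w = run a b ++ v ∧ v.head? ≠ some true ∧ (b = 0 → v = []) := by
  induction w with
  | nil => exact ⟨0, 0, [], by simp [run]⟩
  | cons c w ih =>
    cases c with
    | false =>
      obtain ⟨a, b, v, rfl, hv⟩ := ih
      exact ⟨a + 1, b, v, (run_succ_append a b v).symm, hv⟩
    | true =>
      obtain ⟨b, v, rfl, hv⟩ := exists_replicate_true_append w
      exact ⟨0, b + 1, v, by simp [run, List.replicate_succ], hv, by omega⟩

lemma pairwise_run (a b : ℕ) : (run a b).Pairwise (· ≤ ·) := by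
  simp only [run, List.pairwise_append, List.pairwise_replicate, List.mem_replicate]
  simp

lemma mem_zSet_zero {w : Word} : w ∈ zSet 0 ↔ w = [] := by
  constructor
  · rintro ⟨h, -⟩
    exact List.length_eq_zero_iff.1 h
  · rintro rfl
    refine ⟨rfl, ?_, by simp⟩
    intro u v a b ha h
    have := congrArg List.length h
    simp at this
    omega

lemma head?_ne_true_of_mem_zSet {n : ℕ} {v : Word} (hv : v ∈ zSet n) : v.head? ≠ some true := by
  rcases Nat.eq_zero_or_pos n with rfl | hn
  · simp [mem_zSet_zero.1 hv]
  · simp [hv.2.2 hn.ne']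

lemma run_zero_right_mem_zSet (n : ℕ) : run n 0 ∈ zSet n := by
  refine ⟨by simp, ?_, ?_⟩
  · intro u v a b ha h _
    rcases Nat.eq_zero_or_pos b with rfl | hb
    · omega
    · have : true ∈ run n 0 := by
        rw [h]
        simp [run, hb.ne']
      simp [run] at this
  · intro hn
    obtain ⟨k, rfl⟩ := Nat.exists_eq_succ_of_ne_zero hn
    rfl

/-- A maximal factor of `0 ^ a 1 ^ b v` is either the displayed run or a maximal factor of `v`. -/
lemma run_append_mem_zSet {a b m : ℕ} {v : Word} (hb : 0 < b) (hab : b < a) (hv : v ∈ zSet m) :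
    run a b ++ v ∈ zSet (a + b + m) := by
  have hhead := head?_ne_true_of_mem_zSet hv
  refine ⟨by simp [hv.1], ?_, ?_⟩
  · intro u v' a' b' ha' h hmax
    obtain ⟨hu, hv', hb0⟩ := hmax
    rw [List.append_assoc] at h
    have inside : ∀ t, u = run a b ++ t → v = t ++ (run a' b' ++ v') → b' < 1 * a' := by
      rintro t rfl rfl
      refine hv.2.1 t v' a' b' ha' (by simp) ⟨?_, hv', hb0⟩
      rcases List.eq_nil_or_concat t with rfl | ⟨t, c, rfl⟩
      · simp
      · simpa using hu
    rcases List.append_eq_append_iff.1 h with ⟨t, h1, h2⟩ | ⟨t, h1, h2⟩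
    · exact inside t h1 h2
    · rcases List.eq_nil_or_concat u with rfl | ⟨u, c, rfl⟩
      · rw [List.nil_append] at h1
        subst h1
        have hb' : 0 < b' := by
          by_contra hb'
          obtain rfl : b' = 0 := by omega
          have hnil : v' = [] := by
            cases v' with
            | nil => rfl
            | cons c v' => cases c <;> simp at hv' hb0
          have : true ∈ run a' 0 ++ v' := by
            rw [h2]
            simp [run, hb.ne']
          simp [run, hnil] at this
        obtain ⟨rfl, rfl, -⟩ := run_append_inj hv' hhead hb' hb h2
        omega
      · cases t with
        | nil =>
          exact inside [] (by simpa using h1.symm) (by simpa using h2.symm)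
        | cons d t =>
          -- A `1` inside the run cannot be followed by the `0` that starts the factor.
          exfalso
          have hd : d = false := by
            obtain ⟨k, rfl⟩ := Nat.exists_eq_succ_of_ne_zero ha'.ne'
            rw [Nat.succ_eq_add_one, run_succ_append] at h2
            simpa using (List.cons.inj h2).1.symm
          have hc : c = true := by
            cases c <;> simp at hu ⊢
          have hp := pairwise_run a b
          rw [h1, List.pairwise_append] at hp
          have := hp.2.2 c (by simp) d (by simp)
          rw [hc, hd] at this
          exact absurd this (by decide)
  · intro _
    obtain ⟨k, rfl⟩ := Nat.exists_eq_succ_of_ne_zero (show a ≠ 0 by omega)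
    rfl

/-- The recursive structure of the sets `𝒵_n`, on which the lists are built. -/
lemma mem_zSet_iff {n : ℕ} (hn : n ≠ 0) {w : Word} :
    w ∈ zSet n ↔ w = run n 0 ∨
      ∃ a b v, 0 < b ∧ b < a ∧ a + b ≤ n ∧ v ∈ zSet (n - (a + b)) ∧ w = run a b ++ v := by
  constructor
  · rintro ⟨hlen, hdec, hhead⟩
    obtain ⟨a, b, v, rfl, hv, hb0⟩ := exists_run_append w
    have ha : 0 < a := by
      rcases Nat.eq_zero_or_pos a with rfl | ha
      · exfalso
        rcases Nat.eq_zero_or_pos b with rfl | hb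
        · simp [run, hb0 rfl] at hlen
          omega
        · obtain ⟨k, rfl⟩ := Nat.exists_eq_succ_of_ne_zero hb.ne'
          simp [run, List.replicate_succ, hn] at hhead
      · exact ha
    have hlt := hdec [] v a b ha (by simp) ⟨by simp, hv, fun h => by simp [hb0 h]⟩
    rcases Nat.eq_zero_or_pos b with rfl | hb
    · left
      obtain rfl := hb0 rfl
      simp at hlen
      simp [hlen]
    · right
      simp at hlen
      refine ⟨a, b, v, hb, by omega, by omega, ⟨by omega, ?_, ?_⟩, rfl⟩
      · intro u v' a' b' ha' h hmax
        refine hdec (run a b ++ u) v' a' b' ha' (by simp [h]) ⟨?_, hmax.2⟩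
        rcases List.eq_nil_or_concat u with rfl | ⟨u, c, rfl⟩
        · obtain ⟨k, rfl⟩ := Nat.exists_eq_succ_of_ne_zero hb.ne'
          simp [run, List.replicate_succ']
        · simpa [← List.append_assoc] using hmax.1
      · intro h
        cases v with
        | nil => simp at hlen; omega
        | cons c v => cases c <;> simp at hv ⊢
  · rintro (rfl | ⟨a, b, v, hb, hab, hle, hv, rfl⟩)
    · exact run_zero_right_mem_zSet n
    · have := run_append_mem_zSet hb hab hv
      rwa [Nat.add_sub_cancel' hle] at this

/-! ### Words at Hamming distance at most one -/

/-- Two words (of the same length) that differ in at most one position. -/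
abbrev Adj (u v : Word) : Prop := hamming u v ≤ 1

lemma hamming_cons (c d : Bool) (u v : Word) :
    hamming (c :: u) (d :: v) = (if c = d then 0 else 1) + hamming u v := by
  cases c <;> cases d <;> simp [hamming, add_comm]

@[simp] lemma hamming_self (u : Word) : hamming u u = 0 := by
  induction u with
  | nil => rfl
  | cons c u ih => simp [hamming_cons, ih]

@[simp] lemma hamming_append_left (p u v : Word) : hamming (p ++ u) (p ++ v) = hamming u v := by
  induction p with
  | nil => rfl
  | cons c p ih => simp [hamming_cons, ih]

lemma hamming_comm (u : Word) : ∀ v, hamming u v = hamming v u := by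
  induction u with
  | nil => intro v; cases v <;> rfl
  | cons c u ih =>
    intro v
    cases v with
    | nil => rfl
    | cons d v => rw [hamming_cons, hamming_cons, ih]; simp only [eq_comm]

lemma Adj.symm {u v : Word} (h : Adj u v) : Adj v u := by
  rwa [Adj, hamming_comm]

lemma adj_cons (c d : Bool) (u : Word) : Adj (c :: u) (d :: u) := by
  rw [Adj, hamming_cons, hamming_self]
  split_ifs <;> omega

lemma Adj.append_left {u v : Word} (p : Word) (h : Adj u v) : Adj (p ++ u) (p ++ v) := by
  rwa [Adj, hamming_append_left]

/-- The last `0` of a run is changed into a `1`. -/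
lemma adj_run {a b c d : ℕ} (x : Word) (ha : a = c + 1) (hd : d = b + 1) :
    Adj (run a b ++ x) (run c d ++ x) := by
  subst ha hd
  have h1 : run (c + 1) b ++ x = List.replicate c false ++ false :: (List.replicate b true ++ x) := by
    simp [run, List.replicate_succ']
  have h2 : run c (b + 1) ++ x = List.replicate c false ++ true :: (List.replicate b true ++ x) := by
    simp [run, List.replicate_succ]
  rw [h1, h2]
  exact (adj_cons _ _ _).append_left _

/-- The `0` after a run is changed into a `1`. -/
lemma adj_run_cons {a b d : ℕ} (x : Word) (hd : d = b + 1) :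
    Adj (run a b ++ false :: x) (run a d ++ x) := by
  subst hd
  have h2 : run a (b + 1) ++ x = run a b ++ true :: x := by
    simp [run, List.replicate_succ']
  rw [h2]
  exact (adj_cons _ _ _).append_left _

/-- The `1` of a factor `0 ^ a 1` in front of a run is changed into a `0`, which merges the two
runs. -/
lemma adj_run_run {a k b c : ℕ} (y : Word) (hc : c = a + 1 + k) :
    Adj (run a 1 ++ (run k b ++ y)) (run c b ++ y) := by
  subst hc
  have h1 : run a 1 ++ (run k b ++ y) = List.replicate a false ++ true :: (run k b ++ y) := by
    simp [run]
  have h2 : run (a + 1 + k) b ++ y = List.replicate a false ++ false :: (run k b ++ y) := by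
    simp [run, add_assoc, Nat.add_comm 1 k, List.replicate_succ, List.replicate_add]
  rw [h1, h2]
  exact (adj_cons _ _ _).append_left _

/-! ### Lists in which consecutive words are adjacent -/

lemma cat_succ (m : ℕ) (F : ℕ → List Word) : cat (m + 1) F = cat m F ++ F (m + 1) := by
  simp [cat, List.range'_concat, Nat.add_comm 1 m]

/-- The list `L` starts with `x`, ends with `y`, and consecutive words differ in at most one
position. -/
structure IsPath (x : Word) (L : List Word) (y : Word) : Prop where
  chain : L.IsChain Adj
  head : L.head? = some x
  last : L.getLast? = some y

namespace IsPath

variable {x y x' y' : Word} {L M : List Word}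

lemma single (x : Word) : IsPath x [x] x := ⟨by simp, rfl, rfl⟩

lemma pair (h : Adj x y) : IsPath x [x, y] y := ⟨by simpa using h, rfl, rfl⟩

lemma append (h : IsPath x L y) (h' : IsPath x' M y') (hadj : Adj y x') :
    IsPath x (L ++ M) y' := by
  refine ⟨h.chain.append h'.chain ?_, ?_, ?_⟩
  · intro u hu v hv
    rw [h.last, Option.mem_some_iff] at hu
    rw [h'.head, Option.mem_some_iff] at hv
    exact hu ▸ hv ▸ hadj
  · simp [List.head?_append, h.head]
  · simp [List.getLast?_append, h'.last]

lemma reverse (h : IsPath x L y) : IsPath y L.reverse x := by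
  refine ⟨List.isChain_reverse.2 (h.chain.imp fun _ _ => Adj.symm), ?_, ?_⟩
  · simpa using h.last
  · simpa using h.head

lemma pre (w : Word) (h : IsPath x L y) : IsPath (w ++ x) (pre w L) (w ++ y) := by
  refine ⟨?_, ?_, ?_⟩
  · exact List.isChain_map_of_isChain (w ++ ·) (fun _ _ => Adj.append_left w) h.chain
  · simp [RunDecreasing.pre, h.head]
  · simp [RunDecreasing.pre, h.last]

lemma alt (i : ℕ) (h : IsPath x L y) :
    IsPath (if i % 2 = 0 then x else y) (alt i L) (if i % 2 = 0 then y else x) := by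
  unfold RunDecreasing.alt
  split_ifs
  · exact h
  · exact h.reverse

/-- The end of each list has to be adjacent to the start of the next one. -/
lemma cat {f g : ℕ → Word} {F : ℕ → List Word} :
    ∀ {m : ℕ}, 1 ≤ m → (∀ j, 1 ≤ j → j ≤ m → IsPath (f j) (F j) (g j)) →
      (∀ j, 1 ≤ j → j < m → Adj (g j) (f (j + 1))) → IsPath (f 1) (cat m F) (g m)
  | 0, hm, _, _ => by omega
  | 1, _, h, _ => by simpa [RunDecreasing.cat] using h 1 le_rfl le_rfl
  | m + 2, _, h, hadj => by
    have ih := cat (m := m + 1) (by omega) (fun j h1 h2 => h j h1 (by omega))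
      (fun j h1 h2 => hadj j h1 (by omega))
    have := ih.append (h (m + 2) (by omega) le_rfl) (hadj (m + 1) (by omega) (by omega))
    rwa [cat_succ]

lemma catDown {f g : ℕ → Word} {F : ℕ → List Word} {m : ℕ} (hm : 1 ≤ m)
    (h : ∀ j, 1 ≤ j → j ≤ m → IsPath (f j) (F j) (g j))
    (hadj : ∀ j, 1 ≤ j → j < m → Adj (g (j + 1)) (f j)) :
    IsPath (f m) (catDown m F) (g 1) := by
  have h1 := (cat (f := g) (g := f) (F := fun j => (F j).reverse) hm
    (fun j h1 h2 => (h j h1 h2).reverse) (fun j h1 h2 => (hadj j h1 h2).symm)).reverse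
  have heq : RunDecreasing.catDown m F = (RunDecreasing.cat m fun j => (F j).reverse).reverse := by
    simp [RunDecreasing.cat, RunDecreasing.catDown, List.flatMap, List.reverse_flatten,
      Function.comp_def]
  rwa [heq]

lemma eq_cons_tail (h : IsPath x L y) : L = x :: L.tail := by
  cases L with
  | nil => simpa using h.head
  | cons z L => simpa using h.head

/-- A path between two different words has a second word. -/
lemma exists_tail (h : IsPath x L y) (hne : x ≠ y) : ∃ s, Adj x s ∧ IsPath s L.tail y := by
  obtain ⟨hc, hh, hl⟩ := h
  cases L with
  | nil => simp at hh
  | cons z L =>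
    cases L with
    | nil => simp at hh hl; exact absurd (hh.symm.trans hl) hne
    | cons s L =>
      obtain rfl : z = x := by simpa using hh
      rw [List.isChain_cons_cons] at hc
      exact ⟨s, hc.1, hc.2, rfl, by simpa using hl⟩

end IsPath

/-! ### The words `0(001)^*` and `(001)^*` -/

/-- The word `0(001)^*` of length `k`. -/
def firstWord (k : ℕ) : Word := starWord [false] w001 k

/-- The word `(001)^*` of length `k`. -/
def lastWord (k : ℕ) : Word := starWord [] w001 k

lemma take_flatten_replicate {k m : ℕ} (h : k ≤ m) :
    ((List.replicate m w001).flatten).take k = lastWord k := by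
  obtain ⟨d, rfl⟩ := Nat.exists_eq_add_of_le h
  rw [List.replicate_add, List.flatten_append, List.take_append_of_le_length]
  · rfl
  · simp [w001]
    omega

lemma firstWord_succ (k : ℕ) : firstWord (k + 1) = false :: lastWord k := by
  rw [← take_flatten_replicate (Nat.le_succ k)]
  rfl

lemma lastWord_add_three (k : ℕ) : lastWord (k + 3) = run 2 1 ++ lastWord k := by
  rw [← take_flatten_replicate (show k ≤ k + 2 by omega)]
  rfl

lemma firstWord_add_four (k : ℕ) : firstWord (k + 4) = run 3 1 ++ lastWord k := by
  rw [firstWord_succ, lastWord_add_three]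
  rfl

lemma firstWord_of_le_three {k : ℕ} (h : k ≤ 3) : firstWord k = run k 0 := by
  interval_cases k <;> rfl

lemma lastWord_of_le_two {k : ℕ} (h : k ≤ 2) : lastWord k = run k 0 := by
  interval_cases k <;> rfl

lemma firstWord_ne_lastWord {k : ℕ} (h : 3 ≤ k) : firstWord k ≠ lastWord k := by
  obtain ⟨k, rfl⟩ := Nat.exists_eq_add_of_le' h
  rcases k with _ | k
  · decide
  · rw [show k + 1 + 3 = k + 4 by rfl, firstWord_add_four, lastWord_add_three (k + 1)]
    simp [run, List.replicate_succ]

/-! ### The blocks are paths -/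

/-- The block for `r = 4 t + 5`, in the general case, with `m = n - r`. Within each of its two
groups only the first run changes from one index `j` to the next, since the reversals make equal
ends of the lists meet. The groups meet with the last `0(001)^*` of one and the last `(001)^*` of
the other, which fit because `0(001)^*` is `0` followed by `(001)^*`. -/
lemma isPath_deltaOne_of_ne {Z : ℕ → List Word} {t m : ℕ} (hm : m ≠ 1)
    (hZ : ∀ k < 4 * t + 5 + m, IsPath (firstWord k) (Z k) (lastWord k)) :
    IsPath (run (4 * t + 3) 1 ++ lastWord (m + 1)) (deltaOne Z (4 * t + 5 + m) (4 * t + 5))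
      (run (4 * t + 4) 1 ++ lastWord m) := by
  rw [deltaOne, if_neg (by omega)]
  rw [show (4 * t + 5 - 3) / 2 = 2 * t + 1 by omega, show (4 * t + 5 - 1) / 2 = 2 * t + 2 by omega,
    show 4 * t + 5 + m - (4 * t + 5) = m by omega]
  have hK := IsPath.cat (m := 2 * t + 1) (by omega)
    (fun j _ _ => ((hZ (m + 1) (by omega)).alt j).pre (run (4 * t + 5 - 1 - j) j))
    (fun j h1 h2 => by
      rw [show (if (j + 1) % 2 = 0 then firstWord (m + 1) else lastWord (m + 1)) =
        (if j % 2 = 0 then lastWord (m + 1) else firstWord (m + 1)) by split_ifs <;> first | rfl | omega]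
      exact adj_run _ (by omega) rfl)
  have hL := IsPath.cat (m := 2 * t + 2) (by omega)
    (fun j _ _ => ((hZ m (by omega)).alt j).pre (run (4 * t + 5 - j) j))
    (fun j h1 h2 => by
      rw [show (if (j + 1) % 2 = 0 then firstWord m else lastWord m) =
        (if j % 2 = 0 then lastWord m else firstWord m) by split_ifs <;> first | rfl | omega]
      exact adj_run _ (by omega) rfl)
  have hmain := hK.append hL.reverse (by
    rw [if_neg (by omega), if_pos (by omega), firstWord_succ,
      show 4 * t + 5 - 1 - (2 * t + 1) = 4 * t + 5 - (2 * t + 2) by omega]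
    exact adj_run_cons _ rfl)
  exact hmain

/-- The block for `r = n - 1`, `n = 4 t + 6`. Here the words with a first run of length `n` are
interleaved with those with a first run of length `n - 1`. -/
lemma isPath_deltaOne_pred (Z : ℕ → List Word) (t : ℕ) :
    IsPath (run (4 * t + 3) 1 ++ lastWord 2) (deltaOne Z (4 * t + 6) (4 * t + 5))
      (run (4 * t + 5) 1) := by
  rw [deltaOne, if_pos (by omega)]
  rw [show (4 * t + 6 - 4) / 2 = 2 * t + 1 by omega, show (4 * t + 6 - 2) / 2 = 2 * t + 2 by omega,
    show (4 * t + 6) / 2 = 2 * t + 3 by omega]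
  have h1 := IsPath.cat (m := 2 * t + 1) (by omega)
    (fun j _ _ => IsPath.single (run (4 * t + 6 - 2 - j) j ++ run 2 0))
    (fun j h1 h2 => adj_run _ (by omega) rfl)
  have h2 := IsPath.cat (m := 2 * t + 1) (by omega)
    (fun j _ _ => (IsPath.pair
      (show Adj (run (4 * t + 6 - j - 1) (j + 1)) (run (4 * t + 6 - 1 - j) j ++ run 1 0) by
        have := (adj_run_cons (a := 4 * t + 6 - 1 - j) (b := j) [] rfl).symm
        rw [List.append_nil] at this
        rw [Nat.sub_right_comm]
        exact this)).alt (j - 1))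
    (fun j h1 h2 => by
      rcases Nat.even_or_odd' j with ⟨i, rfl | rfl⟩
      · rw [if_neg (by omega), if_pos (by omega)]
        simpa using adj_run (a := 4 * t + 6 - 2 * i - 1) (b := 2 * i + 1)
          (c := 4 * t + 6 - (2 * i + 1) - 1) [] (by omega) rfl
      · rw [if_pos (by omega), if_neg (by omega)]
        exact adj_run _ (by omega) rfl)
  have h3 := h1.append (IsPath.single (run (2 * t + 3) (2 * t + 2) ++ run 1 0)) (by
    rw [show 4 * t + 6 - 2 - (2 * t + 1) = 2 * t + 3 by omega]
    exact adj_run_cons _ rfl)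
  have h4 := h3.append h2.reverse (by
    rw [if_pos (by omega)]
    exact (adj_run _ (by omega) rfl).symm)
  have h5 := h4.append (IsPath.single (run (4 * t + 6 - 1) 1)) (by
    rw [if_pos (by omega)]
    simpa using (adj_run (a := 4 * t + 6 - 1) (b := 1) (c := 4 * t + 6 - 1 - 1) [] (by omega) rfl).symm)
  exact h5

/-- The block for `r = 4 t + 7`, in the general case, with `m = n - r`. The first words of all lists
`L i` are visited on the way to large `i`; on the way back the remainders of the `L i` start or end
at the second word `s` of `Z m`. This word exists because `m ≥ 3`. -/
lemma isPath_deltaThree_of_le {Z : ℕ → List Word} {t m : ℕ} (hm : 3 ≤ m)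
    (hZ : ∀ k < 4 * t + 7 + m, IsPath (firstWord k) (Z k) (lastWord k)) :
    IsPath (run (4 * t + 6) 1 ++ firstWord m) (deltaThree Z (4 * t + 7 + m) (4 * t + 7))
      (run (4 * t + 6) 1 ++ lastWord m) := by
  rw [deltaThree, if_neg (by omega), if_neg (by omega), if_neg (by omega), if_neg (by omega)]
  rw [show (4 * t + 7 - 3) / 2 = 2 * t + 2 by omega,
    show 4 * t + 7 + m - (4 * t + 7) = m by omega]
  dsimp only
  have hZm := hZ m (by omega)
  obtain ⟨s, hs, hpath⟩ := hZm.exists_tail (firstWord_ne_lastWord hm)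
  have htake (i : ℕ) : (pre (run (4 * t + 7 - i) i) (Z m)).take 1 =
      [run (4 * t + 7 - i) i ++ firstWord m] := by
    rw [hZm.eq_cons_tail]
    rfl
  have htail (i : ℕ) : (pre (run (4 * t + 7 - i) i) (Z m)).tail =
      pre (run (4 * t + 7 - i) i) (Z m).tail := by
    simp [pre]
  simp only [htake, htail]
  have h1 := IsPath.cat (m := 2 * t + 2 + 1) (by omega)
    (fun j _ _ => IsPath.single (run (4 * t + 7 - j) j ++ firstWord m))
    (fun j h1 h2 => adj_run _ (by omega) rfl)
  have h2 := IsPath.catDown (m := 2 * t + 2) (by omega)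
    (fun i _ _ => ((hpath.pre (run (4 * t + 7 - (i + 1)) (i + 1))).append
      ((hZ (m + 1) (by omega)).pre (run (4 * t + 7 - 1 - i) i)) (by
        rw [firstWord_succ, Nat.sub_sub, Nat.add_comm 1 i]
        exact (adj_run_cons _ rfl).symm)).alt i)
    (fun i h1 h2 => by
      rcases Nat.even_or_odd' i with ⟨j, rfl | rfl⟩
      · rw [if_neg (by omega), if_pos (by omega)]
        exact (adj_run _ (by omega) rfl).symm
      · rw [if_pos (by omega), if_neg (by omega)]
        exact (adj_run _ (by omega) rfl).symm)
  have h3 := h1.append h2 (by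
    rw [if_pos (by omega)]
    exact hs.append_left _)
  have h4 := h3.append (hpath.pre (run (4 * t + 7 - 1) 1)) (by
    rw [if_neg (by omega)]
    exact (adj_run _ (by omega) rfl).symm)
  exact h4

/-- The block for `r = n - 2`, `n = 4 t + 9`. -/
lemma isPath_deltaThree_pred_pred {Z : ℕ → List Word} {t : ℕ}
    (hZ : ∀ k < 4 * t + 9, IsPath (firstWord k) (Z k) (lastWord k)) :
    IsPath (run (4 * t + 5) 1 ++ run 3 0) (deltaThree Z (4 * t + 9) (4 * t + 7))
      (run (4 * t + 6) 1 ++ lastWord 2) := by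
  rw [deltaThree, if_neg (by omega), if_pos (by omega)]
  rw [show (4 * t + 9 - 5) / 2 = 2 * t + 2 by omega, show (4 * t + 9 - 3) / 2 = 2 * t + 3 by omega]
  have h1 := IsPath.cat (m := 2 * t + 2) (by omega)
    (fun j _ _ => ((hZ 3 (by omega)).alt (j - 1)).pre (run (4 * t + 9 - 3 - j) j))
    (fun j h1 h2 => by
      rw [show (if (j + 1 - 1) % 2 = 0 then firstWord 3 else lastWord 3) =
        (if (j - 1) % 2 = 0 then lastWord 3 else firstWord 3) by split_ifs <;> first | rfl | omega]
      exact adj_run _ (by omega) rfl)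
  have h2 := IsPath.cat (m := 2 * t + 3) (by omega)
    (fun j _ _ => (hZ 2 (by omega)).pre (run (4 * t + 9 - 2 - j) j))
    (fun j h1 h2 => by exact adj_run _ (by omega) rfl)
  have h3 := h1.append h2.reverse (by
    rw [if_neg (by omega), show 4 * t + 9 - 3 - (2 * t + 2) = 4 * t + 9 - 2 - (2 * t + 3) by omega]
    exact adj_run_cons _ rfl)
  exact h3

/-- The block for `r = n - 1`, `n = 4 t + 8`. It leaves out the word `0 ^ (n - 1) 1`. -/
lemma isPath_deltaThree_pred {Z : ℕ → List Word} {t : ℕ} (h1Z : Z 1 = [run 1 0])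
    (h2Z : Z 2 = [run 2 0]) :
    IsPath (run (4 * t + 5) 1 ++ run 2 0) (deltaThree Z (4 * t + 8) (4 * t + 7))
      (run (4 * t + 6) 1 ++ lastWord 1) := by
  rw [deltaThree, if_neg (by omega), if_neg (by omega), if_pos (by omega)]
  rw [show (4 * t + 8 - 4) / 2 = 2 * t + 2 by omega, show (4 * t + 8 - 2) / 2 = 2 * t + 3 by omega,
    show (4 * t + 8) / 2 = 2 * t + 4 by omega, h1Z, h2Z]
  have h1 := IsPath.cat (m := 2 * t + 2) (by omega)
    (fun j _ _ => IsPath.single (run (4 * t + 8 - 2 - j) j ++ run 2 0))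
    (fun j h1 h2 => adj_run _ (by omega) rfl)
  have h2 := IsPath.cat (m := 2 * t + 2) (by omega)
    (fun j _ _ => (IsPath.pair
      (show Adj (run (4 * t + 8 - 1 - j) (j + 1)) (run (4 * t + 8 - 1 - j) j ++ run 1 0) by
        simpa [run] using (adj_run_cons (a := 4 * t + 8 - 1 - j) (b := j) [] rfl).symm)).alt j)
    (fun j h1 h2 => by
      rcases Nat.even_or_odd' j with ⟨i, rfl | rfl⟩
      · rw [if_pos (by omega), if_neg (by omega)]
        exact adj_run _ (by omega) rfl
      · rw [if_neg (by omega), if_pos (by omega)]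
        simpa using adj_run (a := 4 * t + 8 - 1 - (2 * i + 1)) (b := 2 * i + 1 + 1)
          (c := 4 * t + 8 - 1 - (2 * i + 1 + 1)) [] (by omega) rfl)
  have h3 := h1.append (IsPath.single (run (2 * t + 4) (2 * t + 3) ++ run 1 0)) (by
    rw [show 4 * t + 8 - 2 - (2 * t + 2) = 2 * t + 4 by omega]
    exact adj_run_cons _ rfl)
  have h4 := h3.append h2.reverse (by
    rw [if_pos (by omega)]
    exact (adj_run _ (by omega) rfl).symm)
  rw [if_neg (by omega)] at h4
  exact h4

/-- The block for `r = n`, `n = 4 t + 7`. -/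
lemma isPath_deltaThree_self (Z : ℕ → List Word) (t : ℕ) :
    IsPath (run (4 * t + 5) 1 ++ run 1 0) (deltaThree Z (4 * t + 7) (4 * t + 7))
      (run (4 * t + 6) 1) := by
  rw [deltaThree, if_neg (by omega), if_neg (by omega), if_neg (by omega), if_pos rfl]
  rw [show (4 * t + 7 - 3) / 2 = 2 * t + 2 by omega, show (4 * t + 7 - 1) / 2 = 2 * t + 3 by omega]
  have h1 := IsPath.cat (m := 2 * t + 2) (by omega)
    (fun j _ _ => IsPath.single (run (4 * t + 7 - 1 - j) j ++ run 1 0))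
    (fun j h1 h2 => adj_run _ (by omega) rfl)
  have h2 := IsPath.cat (m := 2 * t + 3) (by omega)
    (fun j _ _ => IsPath.single (run (4 * t + 7 - j) j))
    (fun j h1 h2 => by
      simpa using adj_run (a := 4 * t + 7 - j) (b := j) (c := 4 * t + 7 - (j + 1)) []
        (by omega) rfl)
  have h3 := h1.append h2.reverse (by
    rw [show 4 * t + 7 - 1 - (2 * t + 2) = 4 * t + 7 - (2 * t + 3) by omega]
    have := adj_run_cons (a := 4 * t + 7 - (2 * t + 3)) (b := 2 * t + 2) [] rfl
    rwa [List.append_nil] at this)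
  exact h3

/-! ### The assembled list is a path -/

lemma filter_range_one (n : ℕ) :
    (List.range (n + 1)).filter (fun r => r % 4 = 1 ∧ 5 ≤ r) =
      (List.range' 1 ((n - 1) / 4)).map (fun t => 4 * t + 1) := by
  refine List.Pairwise.eq_of_mem_iff (r := (· < ·)) (List.pairwise_lt_range.filter _) ?_ ?_
  · rw [List.pairwise_map]
    exact (List.pairwise_lt_range' (s := 1)).imp (fun h => by omega)
  · intro r
    simp only [List.mem_filter, List.mem_range, decide_eq_true_eq, List.mem_map,
      List.mem_range'_1]
    constructor
    · intro h
      exact ⟨r / 4, by omega, by omega⟩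
    · rintro ⟨t, h, rfl⟩
      omega

lemma filter_range_three (n : ℕ) :
    (List.range (n + 1)).filter (fun r => r % 4 = 3) =
      (List.range' 1 ((n + 1) / 4)).map (fun t => 4 * t - 1) := by
  refine List.Pairwise.eq_of_mem_iff (r := (· < ·)) (List.pairwise_lt_range.filter _) ?_ ?_
  · rw [List.pairwise_map]
    exact (List.pairwise_lt_range' (s := 1)).imp (fun h => by omega)
  · intro r
    simp only [List.mem_filter, List.mem_range, decide_eq_true_eq, List.mem_map,
      List.mem_range'_1]
    constructor
    · intro h
      exact ⟨r / 4 + 1, by omega, by omega⟩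
    · rintro ⟨t, h, rfl⟩
      omega

lemma assemble_eq (Z : ℕ → List Word) (n : ℕ) :
    assemble Z n = cat ((n - 1) / 4) (fun t => deltaOne Z n (4 * t + 1))
      ++ ((if n % 4 = 0 then [run (n - 1) 1] else []) ++ [run n 0])
      ++ catDown ((n + 1) / 4) (fun t => deltaThree Z n (4 * t - 1)) := by
  rw [assemble, filter_range_one, filter_range_three, ← List.map_reverse, List.flatMap_map,
    List.flatMap_map, cat, catDown]
  simp only [List.append_assoc]

/-- For `r = 4 t + 1 = n - 1` the last word is `0 ^ r 1`, and not `0 ^ (r - 1) 1 0`. -/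
lemma isPath_deltaOne {Z : ℕ → List Word} {n t : ℕ} (ht : 1 ≤ t) (htn : 4 * t + 1 ≤ n)
    (hZ : ∀ k < n, IsPath (firstWord k) (Z k) (lastWord k)) :
    IsPath (run (4 * t - 1) 1 ++ lastWord (n - 4 * t)) (deltaOne Z n (4 * t + 1))
      (if n = 4 * t + 2 then run (4 * t + 1) 1
        else run (4 * t) 1 ++ lastWord (n - (4 * t + 1))) := by
  obtain ⟨t, rfl⟩ := Nat.exists_eq_add_of_le' ht
  obtain ⟨m, rfl⟩ := Nat.exists_eq_add_of_le htn
  split_ifs with h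
  · obtain rfl : m = 1 := by omega
    have := isPath_deltaOne_pred Z t
    rwa [show 4 * (t + 1) - 1 = 4 * t + 3 by omega,
      show 4 * (t + 1) + 1 + 1 - 4 * (t + 1) = 2 by omega]
  · have := isPath_deltaOne_of_ne (t := t) (m := m) (by omega) hZ
    rwa [show 4 * (t + 1) - 1 = 4 * t + 3 by omega,
      show 4 * (t + 1) + 1 + m - 4 * (t + 1) = m + 1 by omega,
      show 4 * (t + 1) + 1 + m - (4 * (t + 1) + 1) = m by omega]

/-- The two forms of the first word: the first one in the general case and for `r = 3`, the second
one for the other blocks with `n - r ≤ 2`. -/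
lemma isPath_deltaThree {Z : ℕ → List Word} {n t : ℕ} (h1Z : Z 1 = [run 1 0])
    (h2Z : Z 2 = [run 2 0]) (hn : 4 ≤ n) (ht : 1 ≤ t) (htn : 4 * t - 1 ≤ n)
    (hZ : ∀ k < n, IsPath (firstWord k) (Z k) (lastWord k)) :
    IsPath (if 4 * t + 2 ≤ n ∨ t = 1 then run (4 * t - 2) 1 ++ firstWord (n - (4 * t - 1))
        else run (4 * t - 3) 1 ++ run (n - (4 * t - 2)) 0)
      (deltaThree Z n (4 * t - 1)) (run (4 * t - 2) 1 ++ lastWord (n - (4 * t - 1))) := by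
  rcases Nat.lt_or_ge 1 t with h1 | h1
  · obtain ⟨t, rfl⟩ := Nat.exists_eq_add_of_le' h1
    obtain ⟨m, rfl⟩ := Nat.exists_eq_add_of_le htn
    rw [show 4 * (t + 2) - 3 = 4 * t + 5 by omega, show 4 * (t + 2) - 2 = 4 * t + 6 by omega,
      show 4 * (t + 2) - 1 = 4 * t + 7 by omega,
      show 4 * t + 7 + m - (4 * t + 7) = m by omega,
      show 4 * t + 7 + m - (4 * t + 6) = m + 1 by omega]
    rw [show 4 * (t + 2) - 1 = 4 * t + 7 by omega] at hZ
    rcases Nat.lt_or_ge m 3 with hm | hm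
    · rw [if_neg (by omega)]
      interval_cases m
      · rw [show lastWord 0 = [] from rfl, List.append_nil]
        exact isPath_deltaThree_self Z t
      · exact isPath_deltaThree_pred h1Z h2Z
      · exact isPath_deltaThree_pred_pred hZ
    · rw [if_pos (by omega)]
      exact isPath_deltaThree_of_le hm hZ
  · obtain rfl : t = 1 := by omega
    rw [if_pos (by omega), deltaThree, if_pos rfl]
    exact (hZ (n - 3) (by omega)).pre _

lemma isPath_cat_deltaOne {Z : ℕ → List Word} {n : ℕ} (hn : 5 ≤ n)
    (hZ : ∀ k < n, IsPath (firstWord k) (Z k) (lastWord k)) :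
    ∃ y, IsPath (firstWord n) (cat ((n - 1) / 4) (fun t => deltaOne Z n (4 * t + 1))) y ∧
      Adj y (if n % 4 = 0 then run (n - 1) 1 else run n 0) := by
  have h := IsPath.cat (m := (n - 1) / 4) (by omega)
    (fun t h1 h2 => isPath_deltaOne (Z := Z) (n := n) h1 (by omega) hZ)
    (fun t h1 h2 => by
      -- `0 ^ (r - 1) 1 001 ⋯` is followed by `0 ^ (r + 2) 1 ⋯`.
      rw [if_neg (by omega), show n - (4 * t + 1) = n - 4 * (t + 1) + 3 by omega,
        lastWord_add_three]
      exact adj_run_run _ (by omega))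
  have hfirst : firstWord n = run (4 * 1 - 1) 1 ++ lastWord (n - 4 * 1) := by
    rw [← Nat.sub_add_cancel (show 4 ≤ n by omega), firstWord_add_four]
    rfl
  rw [← hfirst] at h
  refine ⟨_, h, ?_⟩
  obtain ⟨T, hT⟩ : ∃ T, T = (n - 1) / 4 := ⟨_, rfl⟩
  rw [← hT]
  split_ifs with h1 h2 h2
  · omega
  · have := adj_run_run (a := 4 * T + 1) (k := 0) (b := 0) (c := n) [] (by omega)
    simpa [run] using this
  · rw [show n - (4 * T + 1) = 0 + 3 by omega, lastWord_add_three,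
        show lastWord 0 = [] from rfl]
    have := adj_run_run (a := 4 * T) (k := 2) (b := 1) (c := n - 1) [] (by omega)
    simpa using this
  · rw [lastWord_of_le_two (by omega)]
    have := adj_run_run (a := 4 * T) (k := n - (4 * T + 1)) (b := 0) (c := n) [] (by omega)
    simpa using this

lemma isPath_catDown_deltaThree {Z : ℕ → List Word} {n : ℕ} (h1Z : Z 1 = [run 1 0])
    (h2Z : Z 2 = [run 2 0]) (hn : 4 ≤ n)
    (hZ : ∀ k < n, IsPath (firstWord k) (Z k) (lastWord k)) :
    ∃ x, IsPath x (catDown ((n + 1) / 4) (fun t => deltaThree Z n (4 * t - 1))) (lastWord n) ∧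
      Adj (run n 0) x := by
  have h := IsPath.catDown (m := (n + 1) / 4) (by omega)
    (fun t h1 h2 => isPath_deltaThree h1Z h2Z hn h1 (by omega) hZ)
    (fun t h1 h2 => by
      -- `0 ^ (r + 3) 1 ⋯` is followed by `0 ^ (r - 1) 1 0001 ⋯`.
      rw [if_pos (by omega), show n - (4 * t - 1) = n - (4 * (t + 1) - 1) + 4 by omega,
        firstWord_add_four]
      exact (adj_run_run _ (by omega)).symm)
  have hlast : lastWord n = run (4 * 1 - 2) 1 ++ lastWord (n - (4 * 1 - 1)) := by
    rw [← Nat.sub_add_cancel (show 3 ≤ n by omega), lastWord_add_three]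
    rfl
  rw [← hlast] at h
  refine ⟨_, h, ?_⟩
  obtain ⟨T, hT⟩ : ∃ T, T = (n + 1) / 4 := ⟨_, rfl⟩
  rw [← hT]
  split_ifs with h1
  · rw [firstWord_of_le_three (by omega)]
    have := adj_run_run (a := 4 * T - 2) (k := n - (4 * T - 1)) (b := 0) (c := n) [] (by omega)
    simpa using this.symm
  · have := adj_run_run (a := 4 * T - 3) (k := n - (4 * T - 2)) (b := 0) (c := n) [] (by omega)
    simpa using this.symm

lemma isPath_assemble {Z : ℕ → List Word} {n : ℕ} (h1Z : Z 1 = [run 1 0])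
    (h2Z : Z 2 = [run 2 0]) (hn : 4 ≤ n)
    (hZ : ∀ k < n, IsPath (firstWord k) (Z k) (lastWord k)) :
    IsPath (firstWord n) (assemble Z n) (lastWord n) := by
  have hmid : IsPath (if n % 4 = 0 then run (n - 1) 1 else run n 0)
      ((if n % 4 = 0 then [run (n - 1) 1] else []) ++ [run n 0]) (run n 0) := by
    split_ifs with h
    · refine IsPath.pair ?_
      have := adj_run (a := n) (b := 0) (c := n - 1) [] (by omega) rfl
      simpa using this.symm
    · exact IsPath.single _
  obtain ⟨x, hx, hxadj⟩ := isPath_catDown_deltaThree h1Z h2Z hn hZ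
  rw [assemble_eq]
  refine IsPath.append ?_ hx hxadj
  rcases Nat.eq_or_lt_of_le hn with rfl | hn
  · exact hmid
  · obtain ⟨y, hy, hyadj⟩ := isPath_cat_deltaOne hn hZ
    exact hy.append hmid hyadj

/-! ### The words of the assembled list -/

/-- The words `0 ^ (s - j) 1 ^ j v` with `1 ≤ j < s - j` and `v` in the list `Z (n - s)`: those
whose first run has length `s` and contains a `1`. -/
def firstRunWords (Z : ℕ → List Word) (n s : ℕ) : Multiset Word :=
  ∑ j ∈ Finset.Icc 1 ((s - 1) / 2), (pre (run (s - j) j) (Z (n - s)) : Multiset Word)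

lemma coe_cat (m : ℕ) (F : ℕ → List Word) :
    (cat m F : Multiset Word) = ∑ j ∈ Finset.Icc 1 m, (F j : Multiset Word) := by
  induction m with
  | zero => rfl
  | succ m ih => rw [cat_succ, ← Multiset.coe_add, ih, Finset.sum_Icc_succ_top (by omega)]

lemma coe_catDown (m : ℕ) (F : ℕ → List Word) :
    (catDown m F : Multiset Word) = ∑ j ∈ Finset.Icc 1 m, (F j : Multiset Word) := by
  rw [← coe_cat, Multiset.coe_eq_coe]
  exact (List.reverse_perm _).flatMap_right _

lemma coe_alt (i : ℕ) (L : List Word) : (alt i L : Multiset Word) = L := by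
  unfold alt
  split_ifs <;> simp

lemma coe_pre_alt (w : Word) (i : ℕ) (L : List Word) :
    (pre w (alt i L) : Multiset Word) = pre w L := by
  rw [Multiset.coe_eq_coe]
  exact (Multiset.coe_eq_coe.1 (coe_alt i L)).map _

lemma coe_filter_flatMap (p : ℕ → Prop) [DecidablePred p] (f : ℕ → List Word) (n : ℕ) :
    (((List.range n).filter p).flatMap f : Multiset Word) =
      ∑ r ∈ Finset.range n, if p r then (f r : Multiset Word) else 0 := by
  induction n with
  | zero => rfl
  | succ n ih =>
    rw [List.range_succ, List.filter_append, List.flatMap_append, ← Multiset.coe_add, ih,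
      Finset.sum_range_succ]
    by_cases h : p n <;> simp [h]

lemma sum_Icc_succ_bot {M : Type*} [AddCommMonoid M] (m : ℕ) (f : ℕ → M) :
    ∑ j ∈ Finset.Icc 1 (m + 1), f j = f 1 + ∑ j ∈ Finset.Icc 1 m, f (j + 1) := by
  induction m with
  | zero => simp
  | succ m ih =>
    rw [Finset.sum_Icc_succ_top (by omega), ih, Finset.sum_Icc_succ_top (by omega), add_assoc]

/-- Every index is the last or the last but one of exactly one pair that ends at an odd index,
except for `n` when it is even. -/
lemma sum_odd_add_pred {M : Type*} [AddCommMonoid M] (g : ℕ → M) (n : ℕ) :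
    ((∑ r ∈ Finset.range (n + 1), if r % 2 = 1 then g (r - 1) + g r else 0) +
      if n % 2 = 0 then g n else 0) = ∑ r ∈ Finset.range (n + 1), g r := by
  induction n with
  | zero => simp
  | succ n ih =>
    rw [Finset.sum_range_succ, Finset.sum_range_succ _ (n + 1), ← ih]
    rcases Nat.mod_two_eq_zero_or_one n with h | h
    · have h' : (n + 1) % 2 = 1 := by omega
      simp [h, h', add_assoc]
    · have h' : (n + 1) % 2 = 0 := by omega
      simp [h, h']

lemma firstRunWords_eq {Z : ℕ → List Word} {n s a k : ℕ} (ha : (s - 1) / 2 = a) (hk : n - s = k) :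
    firstRunWords Z n s =
      ∑ j ∈ Finset.Icc 1 a, (pre (run (s - j) j) (Z k) : Multiset Word) := by
  rw [firstRunWords, ha, hk]

lemma firstRunWords_of_le_two {Z : ℕ → List Word} {n s : ℕ} (h : s ≤ 2) :
    firstRunWords Z n s = 0 := by
  rw [firstRunWords, show (s - 1) / 2 = 0 by omega]
  rfl

lemma firstRunWords_self {Z : ℕ → List Word} (h0Z : Z 0 = [[]]) (n : ℕ) :
    firstRunWords Z n n = ∑ j ∈ Finset.Icc 1 ((n - 1) / 2), {run (n - j) j} := by
  rw [firstRunWords_eq rfl (Nat.sub_self n), h0Z]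
  simp [pre]

lemma coe_deltaOne {Z : ℕ → List Word} {n r : ℕ} (h0Z : Z 0 = [[]]) (h1Z : Z 1 = [run 1 0])
    (h2Z : Z 2 = [run 2 0]) (hr : r % 4 = 1) (h5 : 5 ≤ r) (hrn : r ≤ n) :
    (deltaOne Z n r : Multiset Word) = firstRunWords Z n (r - 1) + firstRunWords Z n r +
      if r = n - 1 then firstRunWords Z n n else 0 := by
  rw [deltaOne]
  split_ifs with h
  · obtain ⟨c, rfl⟩ : ∃ c, n = 2 * c + 4 := ⟨(n - 4) / 2, by omega⟩
    subst h
    rw [firstRunWords_self h0Z,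
      firstRunWords_eq (a := c) (k := 2) (by omega) (by omega),
      firstRunWords_eq (a := c + 1) (k := 1) (by omega) (by omega),
      show (2 * c + 4 - 1) / 2 = c + 1 by omega, show (2 * c + 4 - 4) / 2 = c by omega,
      show (2 * c + 4 - 2) / 2 = c + 1 by omega, show (2 * c + 4) / 2 = c + 2 by omega,
      Finset.sum_Icc_succ_top (by omega), sum_Icc_succ_bot, h1Z, h2Z,
      show 2 * c + 4 - 1 - (c + 1) = c + 2 by omega]
    simp only [← Multiset.coe_add, Multiset.coe_reverse, coe_cat, coe_alt, pre, List.map_cons,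
      List.map_nil, Nat.sub_sub, ← Multiset.cons_coe,
      ← Multiset.singleton_add, Finset.sum_add_distrib, Multiset.coe_nil, add_zero,
      Nat.add_comm 1, Nat.reduceAdd]
    abel
  · rw [firstRunWords_eq (a := (r - 3) / 2) (k := n - r + 1) (by omega) (by omega),
      firstRunWords_eq (s := r) rfl rfl]
    simp only [← Multiset.coe_add, Multiset.coe_reverse, coe_cat, coe_pre_alt, add_zero]

/-- In the case `r = n - 1` the word `0 ^ (n - 1) 1` is not in the block, but in front of `0 ^ n`. -/
lemma coe_deltaThree {Z : ℕ → List Word} {n r : ℕ} (h0Z : Z 0 = [[]]) (h1Z : Z 1 = [run 1 0])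
    (h2Z : Z 2 = [run 2 0]) (hn : 4 ≤ n) (hr : r % 4 = 3) (hrn : r ≤ n) :
    ((deltaThree Z n r : Multiset Word) + if r = n - 1 then {run (n - 1) 1} else 0) =
      firstRunWords Z n (r - 1) + firstRunWords Z n r +
        if r = n - 1 then firstRunWords Z n n else 0 := by
  rw [deltaThree]
  by_cases h3 : r = 3
  · subst h3
    rw [if_pos rfl, firstRunWords_of_le_two le_rfl, firstRunWords_eq (s := 3) (a := 1) rfl rfl]
    split_ifs with h
    · obtain rfl : n = 4 := by omega
      rw [firstRunWords_self h0Z]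
      simp
    · simp
  rw [if_neg h3]
  by_cases h2 : r = n - 2
  · obtain ⟨c, rfl⟩ : ∃ c, n = 2 * c + 5 := ⟨(n - 5) / 2, by omega⟩
    rw [if_pos h2, if_neg (by omega), if_neg (by omega), h2,
      firstRunWords_eq (a := c) (k := 3) (by omega) (by omega),
      firstRunWords_eq (a := c + 1) (k := 2) (by omega) (by omega),
      show (2 * c + 5 - 3) / 2 = c + 1 by omega, show (2 * c + 5 - 5) / 2 = c by omega]
    simp only [← Multiset.coe_add, Multiset.coe_reverse, coe_cat, coe_pre_alt, add_zero,
      Nat.sub_sub, Nat.reduceAdd]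
  rw [if_neg h2]
  by_cases h1 : r = n - 1
  · obtain ⟨c, rfl⟩ : ∃ c, n = 2 * c + 4 := ⟨(n - 4) / 2, by omega⟩
    rw [if_pos h1, if_pos h1, if_pos h1, h1, firstRunWords_self h0Z,
      firstRunWords_eq (a := c) (k := 2) (by omega) (by omega),
      firstRunWords_eq (a := c + 1) (k := 1) (by omega) (by omega),
      show (2 * c + 4 - 1) / 2 = c + 1 by omega, show (2 * c + 4 - 4) / 2 = c by omega,
      show (2 * c + 4 - 2) / 2 = c + 1 by omega, show (2 * c + 4) / 2 = c + 2 by omega,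
      Finset.sum_Icc_succ_top (by omega), sum_Icc_succ_bot, h1Z, h2Z,
      show 2 * c + 4 - 1 - (c + 1) = c + 2 by omega]
    simp only [← Multiset.coe_add, Multiset.coe_reverse, coe_cat, coe_alt, pre, List.map_cons,
      List.map_nil, Multiset.coe_singleton, Nat.sub_sub, Finset.sum_add_distrib,
      Nat.add_comm 1, Nat.reduceAdd]
    abel
  rw [if_neg h1, if_neg h1, if_neg h1, add_zero, add_zero]
  by_cases h0 : r = n
  · subst h0
    rw [if_pos rfl, firstRunWords_self h0Z,
      firstRunWords_eq (a := (r - 3) / 2) (k := 1) (by omega) (by omega), h1Z]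
    simp only [← Multiset.coe_add, Multiset.coe_reverse, coe_cat, pre, List.map_cons,
      List.map_nil, Multiset.coe_singleton]
  rw [if_neg h0]
  obtain ⟨a, rfl⟩ : ∃ a, r = 2 * a + 3 := ⟨(r - 3) / 2, by omega⟩
  have hsplit (L : List Word) : (L : Multiset Word) = (L.take 1 : Multiset Word) + L.tail := by
    cases L <;> rfl
  rw [firstRunWords_eq (a := a) (k := n - (2 * a + 3) + 1) (by omega) (by omega),
    firstRunWords_eq (s := 2 * a + 3) (a := a + 1) (by omega) rfl,
    show (2 * a + 3 - 3) / 2 = a by omega,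
    Finset.sum_congr rfl (fun j _ => hsplit (pre (run (2 * a + 3 - j) j) _)),
    Finset.sum_add_distrib, sum_Icc_succ_bot a (fun j => ((pre _ _).tail : Multiset Word))]
  simp only [← Multiset.coe_add, coe_cat, coe_catDown, coe_alt, Finset.sum_add_distrib]
  abel

/-- The block for the odd number `r` exhausts the words with a first run of length `r - 1` or `r`;
for even `n` the words with a first run of length `n` belong to `r = n - 1`. -/
lemma coe_assemble {Z : ℕ → List Word} {n : ℕ} (h0Z : Z 0 = [[]]) (h1Z : Z 1 = [run 1 0])
    (h2Z : Z 2 = [run 2 0]) (hn : 4 ≤ n) :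
    (assemble Z n : Multiset Word) =
      {run n 0} + ∑ s ∈ Finset.range (n + 1), firstRunWords Z n s := by
  have hterm : ∀ r ∈ Finset.range (n + 1),
      ((if r % 4 = 1 ∧ 5 ≤ r then (deltaOne Z n r : Multiset Word) else 0) +
        (if r = n - 1 then if n % 4 = 0 then {run (n - 1) 1} else 0 else 0) +
        if r % 4 = 3 then (deltaThree Z n r : Multiset Word) else 0) =
      (if r % 2 = 1 then firstRunWords Z n (r - 1) + firstRunWords Z n r else 0) +
        if r = n - 1 then if n % 2 = 0 then firstRunWords Z n n else 0 else 0 := by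
    intro r hr
    have hrn : r ≤ n := by simpa [Nat.lt_succ_iff] using hr
    by_cases h3 : r % 4 = 3
    · have := coe_deltaThree h0Z h1Z h2Z hn h3 hrn
      rw [if_neg (by omega), if_pos h3, if_pos (show r % 2 = 1 by omega), zero_add, add_comm]
      convert this using 2
      · split_ifs <;> first | rfl | omega
      · split_ifs <;> first | rfl | omega
    rw [if_neg h3, add_zero]
    have hE : (if r = n - 1 then if n % 4 = 0 then ({run (n - 1) 1} : Multiset Word) else 0 else 0)
        = 0 := by
      split_ifs <;> first | rfl | omega
    rw [hE, add_zero]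
    by_cases h1 : r % 4 = 1 ∧ 5 ≤ r
    · rw [if_pos h1, if_pos (show r % 2 = 1 by omega), coe_deltaOne h0Z h1Z h2Z h1.1 h1.2 hrn]
      congr 1
      split_ifs <;> first | rfl | omega
    · rw [if_neg h1]
      by_cases hodd : r % 2 = 1
      · rw [if_pos hodd, if_neg (by omega), firstRunWords_of_le_two (by omega),
          firstRunWords_of_le_two (by omega)]
        rfl
      · rw [if_neg hodd]
        split_ifs <;> first | rfl | omega
  have hsum := Finset.sum_congr rfl hterm
  rw [Finset.sum_add_distrib, Finset.sum_add_distrib, Finset.sum_add_distrib, Finset.sum_ite_eq',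
    Finset.sum_ite_eq', if_pos (Finset.mem_range.2 (by omega)),
    if_pos (Finset.mem_range.2 (by omega)), sum_odd_add_pred] at hsum
  have hrev : (((List.range (n + 1)).filter (fun r => r % 4 = 3)).reverse.flatMap (deltaThree Z n) :
      Multiset Word) = ((List.range (n + 1)).filter (fun r => r % 4 = 3)).flatMap (deltaThree Z n) := by
    rw [Multiset.coe_eq_coe]
    exact (List.reverse_perm _).flatMap_right _
  have hE : ((if n % 4 = 0 then [run (n - 1) 1] else [] : List Word) : Multiset Word) =
      if n % 4 = 0 then {run (n - 1) 1} else 0 := by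
    split_ifs <;> rfl
  rw [← hsum, assemble, ← Multiset.coe_add, ← Multiset.coe_add, ← Multiset.coe_add, hrev,
    coe_filter_flatMap, coe_filter_flatMap, hE, Multiset.coe_singleton]
  abel

/-! ### Each word is listed exactly once -/

/-- A list with the words of `0 ^ n` and of `firstRunWords Z n s`, `s ≤ n`, in a simple order. -/
def plainList (Z : ℕ → List Word) (n : ℕ) : List Word :=
  run n 0 :: (List.range (n + 1)).flatMap
    (fun s => cat ((s - 1) / 2) (fun j => pre (run (s - j) j) (Z (n - s))))

lemma coe_plainList (Z : ℕ → List Word) (n : ℕ) :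
    (plainList Z n : Multiset Word) =
      {run n 0} + ∑ s ∈ Finset.range (n + 1), firstRunWords Z n s := by
  have := coe_filter_flatMap (fun _ => True)
    (fun s => cat ((s - 1) / 2) (fun j => pre (run (s - j) j) (Z (n - s)))) (n + 1)
  simp only [if_true, decide_true, List.filter_true, coe_cat] at this
  rw [plainList, ← Multiset.cons_coe, this, ← Multiset.singleton_add]
  rfl

lemma mem_cat_pre {Z : ℕ → List Word} {m k s : ℕ} {w : Word} :
    w ∈ cat m (fun j => pre (run (s - j) j) (Z k)) ↔
      ∃ j, 1 ≤ j ∧ j ≤ m ∧ ∃ v ∈ Z k, run (s - j) j ++ v = w := by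
  simp only [cat, pre, List.mem_flatMap, List.mem_range'_1, List.mem_map]
  refine exists_congr fun j => ?_
  rw [and_assoc]
  refine and_congr_right fun _ => and_congr_left fun _ => by omega

lemma mem_plainList {Z : ℕ → List Word} {n : ℕ} (hn : n ≠ 0)
    (hZ : ∀ k < n, ∀ w, w ∈ Z k ↔ w ∈ zSet k) (w : Word) : w ∈ plainList Z n ↔ w ∈ zSet n := by
  rw [mem_zSet_iff hn, plainList, List.mem_cons]
  refine or_congr_right ?_
  simp only [List.mem_flatMap, List.mem_range, mem_cat_pre]
  constructor
  · rintro ⟨s, hs, j, h1, h2, v, hv, rfl⟩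
    refine ⟨s - j, j, v, by omega, by omega, by omega, ?_, rfl⟩
    rw [Nat.sub_add_cancel (by omega)]
    exact (hZ _ (by omega) _).1 hv
  · rintro ⟨a, b, v, hb, hab, hle, hv, rfl⟩
    refine ⟨a + b, by omega, b, hb, by omega, v, (hZ _ (by omega) _).2 hv, ?_⟩
    rw [Nat.add_sub_cancel]

lemma nodup_plainList {Z : ℕ → List Word} {n : ℕ}
    (hZ : ∀ k < n, ∀ w, w ∈ Z k ↔ w ∈ zSet k) (hnd : ∀ k < n, (Z k).Nodup) :
    (plainList Z n).Nodup := by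
  rw [plainList, List.nodup_cons]
  constructor
  · simp only [List.mem_flatMap, List.mem_range, mem_cat_pre, not_exists, not_and]
    intro s _ j h1 _ v _ h
    have : true ∈ run n 0 := by
      rw [← h]
      simp [run]
      omega
    simp [run] at this
  · rw [List.nodup_flatMap]
    constructor
    · intro s hs
      rw [cat, List.nodup_flatMap]
      constructor
      · intro j hj
        rw [List.mem_range'_1] at hj
        rw [List.mem_range] at hs
        exact (hnd _ (by omega)).map (List.append_right_injective _)
      · refine (List.nodup_range' (s := 1)).pairwise_of_forall_ne ?_
        intro i hi j hj hij w hwi hwj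
        rw [List.mem_range'_1] at hi hj
        rw [List.mem_range] at hs
        obtain ⟨v, hv, rfl⟩ := List.mem_map.1 hwi
        obtain ⟨v', hv', h⟩ := List.mem_map.1 hwj
        have := run_append_inj (head?_ne_true_of_mem_zSet ((hZ _ (by omega) _).1 hv'))
          (head?_ne_true_of_mem_zSet ((hZ _ (by omega) _).1 hv)) (by omega) (by omega) h
        omega
    · refine List.nodup_range.pairwise_of_forall_ne ?_
      intro s hs s' hs' hne w hw hw'
      rw [List.mem_range] at hs hs'
      obtain ⟨j, h1, h2, v, hv, rfl⟩ := mem_cat_pre.1 hw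
      obtain ⟨j', h1', h2', v', hv', h⟩ := mem_cat_pre.1 hw'
      have := run_append_inj (head?_ne_true_of_mem_zSet ((hZ _ (by omega) _).1 hv'))
        (head?_ne_true_of_mem_zSet ((hZ _ (by omega) _).1 hv)) (by omega) (by omega) h
      omega

/-! ### The family of lists -/

lemma deltaOne_congr {Z Z' : ℕ → List Word} {n r : ℕ} (hr : 5 ≤ r) (hrn : r ≤ n)
    (h : ∀ k < n, Z k = Z' k) : deltaOne Z n r = deltaOne Z' n r := by
  rw [deltaOne, deltaOne, h (n - r) (by omega), h (n - r + 1) (by omega)]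

lemma deltaThree_congr {Z Z' : ℕ → List Word} {n r : ℕ} (hn : 4 ≤ n) (hr : 3 ≤ r) (hrn : r ≤ n)
    (h : ∀ k < n, Z k = Z' k) : deltaThree Z n r = deltaThree Z' n r := by
  rw [deltaThree, deltaThree, h (n - r) (by omega), h (n - r + 1) (by omega), h (n - 3) (by omega),
    h 1 (by omega), h 2 (by omega), h 3 (by omega)]

lemma assemble_congr {Z Z' : ℕ → List Word} {n : ℕ} (hn : 4 ≤ n)
    (h : ∀ k < n, Z k = Z' k) : assemble Z n = assemble Z' n := by
  have h1 : ((List.range (n + 1)).filter (fun r => r % 4 = 1 ∧ 5 ≤ r)).flatMap (deltaOne Z n) =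
      ((List.range (n + 1)).filter (fun r => r % 4 = 1 ∧ 5 ≤ r)).flatMap (deltaOne Z' n) := by
    refine List.flatMap_congr fun r hr => ?_
    simp only [List.mem_filter, List.mem_range, decide_eq_true_eq] at hr
    exact deltaOne_congr (by omega) (by omega) h
  have h3 : ((List.range (n + 1)).filter (fun r => r % 4 = 3)).reverse.flatMap (deltaThree Z n) =
      ((List.range (n + 1)).filter (fun r => r % 4 = 3)).reverse.flatMap (deltaThree Z' n) := by
    refine List.flatMap_congr fun r hr => ?_
    simp only [List.mem_reverse, List.mem_filter, List.mem_range, decide_eq_true_eq] at hr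
    exact deltaThree_congr hn (by omega) (by omega) h
  rw [assemble, assemble, h1, h3]

/-- The lists `Z 0, Z 1, Z 2, …`. The blocks for `n` only use the lists `Z k` with `k < n`, which
makes the recursion well founded; `assemble` gets the empty list as a placeholder for the others. -/
def diagonalFamily : ℕ → List Word
  | 0 => [[]]
  | 1 => [run 1 0]
  | 2 => [run 2 0]
  | 3 => [run 3 0, run 2 1]
  | n + 4 => assemble (fun k => if k < n + 4 then diagonalFamily k else []) (n + 4)

lemma isDiagonalFamily_diagonalFamily : IsDiagonalFamily diagonalFamily := by
  refine ⟨by rw [diagonalFamily], by rw [diagonalFamily], by rw [diagonalFamily],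
    by rw [diagonalFamily], ?_⟩
  intro n hn
  obtain ⟨n, rfl⟩ := Nat.exists_eq_add_of_le' hn
  rw [diagonalFamily]
  exact assemble_congr hn fun k hk => if_pos hk

namespace IsDiagonalFamily

variable {Z : ℕ → List Word}

lemma isPath (hZ : IsDiagonalFamily Z) (n : ℕ) : IsPath (firstWord n) (Z n) (lastWord n) := by
  obtain ⟨h0, h1, h2, h3, h4⟩ := hZ
  induction n using Nat.strong_induction_on with
  | _ n ih =>
    rcases Nat.lt_or_ge n 4 with hn | hn
    · interval_cases n
      · rw [h0]; exact IsPath.single _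
      · rw [h1]; exact IsPath.single _
      · rw [h2]; exact IsPath.single _
      · rw [h3]; exact IsPath.pair (by decide)
    · rw [h4 n hn]
      exact isPath_assemble h1 h2 hn ih

/-- Each list is a rearrangement of the plain list, also for `1 ≤ n ≤ 3`. -/
lemma perm_plainList (hZ : IsDiagonalFamily Z) {n : ℕ} (hn : n ≠ 0) :
    (Z n).Perm (plainList Z n) := by
  obtain ⟨h0, h1, h2, h3, h4⟩ := hZ
  rcases Nat.lt_or_ge n 4 with hn' | hn'
  · have : n = 1 ∨ n = 2 ∨ n = 3 := by omega
    rcases this with rfl | rfl | rfl <;>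
      simp [plainList, List.range_succ, cat, pre, h0, h1, h2, h3]
  · rw [← Multiset.coe_eq_coe, coe_plainList, h4 n hn', coe_assemble h0 h1 h2 hn']

lemma nodup_and_mem (hZ : IsDiagonalFamily Z) (n : ℕ) :
    (Z n).Nodup ∧ ∀ w, w ∈ Z n ↔ w ∈ zSet n := by
  induction n using Nat.strong_induction_on with
  | _ n ih =>
    rcases eq_or_ne n 0 with rfl | hn
    · rw [hZ.1]
      simp [mem_zSet_zero]
    · have hperm := hZ.perm_plainList hn
      refine ⟨hperm.nodup_iff.2 (nodup_plainList (fun k hk => (ih k hk).2) fun k hk => (ih k hk).1),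
        fun w => ?_⟩
      rw [hperm.mem_iff, mem_plainList hn fun k hk => (ih k hk).2]

end IsDiagonalFamily

end RunDecreasing

theorem theorem3 :
    ∃ Z : ℕ → List RunDecreasing.Word,
      RunDecreasing.IsDiagonalFamily Z ∧
      ∀ n : ℕ,
        RunDecreasing.IsGrayCode 1 n (RunDecreasing.zSet n) (Z n) ∧
        (Z n).head? = some (RunDecreasing.starWord [false] RunDecreasing.w001 n) ∧
        (Z n).getLast? = some (RunDecreasing.starWord [] RunDecreasing.w001 n) := by
  have hZ := RunDecreasing.isDiagonalFamily_diagonalFamily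
  refine ⟨_, hZ, fun n => ?_⟩
  have hpath := hZ.isPath n
  obtain ⟨hnodup, hmem⟩ := hZ.nodup_and_mem n
  exact ⟨⟨fun w hw => hw.1, hnodup, hmem, hpath.chain⟩, hpath.head, hpath.last⟩
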